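/- Let $G=(V,E)$ be a finite simple graph. A polytope in $\mathbb{R}^V$ is the convex hull of a finite nonempty set of points. Let $(e_v)_{v\in V}$ be the canonical basis of $\mathbb{R}^V$, and let $Z_G=\sum_{\{u,v\}\in E}[e_u,e_v]\subset\mathbb{R}^V$ (Minkowski sum of segments, the empty sum being $\{0\}$) be the graphical zonotope of $G$. Let $\mathbb{V}$ be the real vector space of virtual polytopes, that is, the Grothendieck group of the monoid of polytopes in $\mathbb{R}^V$ under Minkowski addition, with $\lambda(P-Q)=\lambda P-\lambda Q$ for $\lambda\ge 0$ and $\lambda(P-Q)=(-\lambda)Q-(-\lambda)P$ for $\lambda<0$. The deformation cone of $Z_G$ is the convex cone $$\mathbb{DC}(Z_G)=\{P \text{ polytope in } \mathbb{R}^V : P+Q=\lambda Z_G \text{ for some polytope } Q \text{ and some } \lambda\ge 0\}\subset\mathbb{V}.$$ The dimension of a cone is the dimension of its linear span, its lineality space is the largest linear subspace contained in it, its faces are the zero-sets on the cone of linear functions that are nonnegative on the cone, and its facets are its faces of codimension $1$. Then: 1. the dimension of $\mathbb{DC}(Z_G)$ is the number of nonempty subsets $K\subseteq V$ that induce a clique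 of $G$ (single vertices included); 2. the lineality space of $\mathbb{DC}(Z_G)$ has dimension $|V|$; 3. the number of facets of $\mathbb{DC}(Z_G)$ is the number of triplets $(u,v,S)$ with $\{u,v\}\in E$ and $S\subseteq N(u)\cap N(v)$, where $N(w)$ is the set of neighbours of $w$ and the triplets $(u,v,S)$ and $(v,u,S)$ are identified (that is, the number of pairs consisting of an edge $\{u,v\}$ and a set $S$ of common neighbours of its ends). -/

import Mathlib

noncomputable section

open scoped Pointwise NNReal

/-! ### Polytopes and virtual polytopes -/

/-- The polytopes of a real vector space `E`, i.e. the convex hulls of finitely many (and at least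
one) points, as a submonoid of the monoid of subsets of `E` under Minkowski addition. -/
def polytopes (E : Type*) [AddCommGroup E] [Module ℝ E] : AddSubmonoid (Set E) where
  carrier := {P | ∃ s : Set E, s.Finite ∧ s.Nonempty ∧ P = convexHull ℝ s}
  zero_mem' := ⟨{0}, Set.finite_singleton 0, Set.singleton_nonempty 0, by simp; rfl⟩
  add_mem' := by
    rintro _ _ ⟨s, hs, hs', rfl⟩ ⟨t, ht, ht', rfl⟩
    exact ⟨s + t, hs.add ht, hs'.add ht', (convexHull_add s t).symm⟩

/-- Polytopes in `E`. Addition is Minkowski addition, zero is the point `{0}`. -/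
def Polytope (E : Type*) [AddCommGroup E] [Module ℝ E] : Type _ := polytopes E

variable {E : Type*} [AddCommGroup E] [Module ℝ E]

instance : AddCommMonoid (Polytope E) := inferInstanceAs (AddCommMonoid (polytopes E))

namespace Polytope

/-- The underlying set of points. -/
def toSet (P : Polytope E) : Set E := P.1

theorem toSet_injective : Function.Injective (toSet : Polytope E → Set E) :=
  Subtype.val_injective

theorem toSet_zero : (0 : Polytope E).toSet = 0 := rfl

theorem toSet_add (P Q : Polytope E) : (P + Q).toSet = P.toSet + Q.toSet := rfl

theorem nonempty (P : Polytope E) : P.toSet.Nonempty := by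
  obtain ⟨_, s, _, hs, rfl⟩ := P
  exact convexHull_nonempty_iff.2 hs

theorem convex (P : Polytope E) : Convex ℝ P.toSet := by
  obtain ⟨_, s, _, _, rfl⟩ := P
  exact convex_convexHull ℝ s

/-- The dilation `P ↦ c P = {c p | p ∈ P}` by a scalar `c ≥ 0`. -/
def dilate (c : ℝ≥0) : Polytope E →+ Polytope E where
  toFun P := ⟨(c : ℝ) • P.toSet, by
    obtain ⟨_, s, hs, hs', rfl⟩ := P
    exact ⟨(c : ℝ) • s, hs.smul_set, hs'.smul_set, (convexHull_smul (c : ℝ) s).symm⟩⟩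
  map_zero' := toSet_injective (smul_zero (c : ℝ))
  map_add' P Q := toSet_injective (smul_add (c : ℝ) P.toSet Q.toSet)

theorem toSet_dilate (c : ℝ≥0) (P : Polytope E) : (dilate c P).toSet = (c : ℝ) • P.toSet := rfl

/-- The line segment `[x, y]`. -/
def lineSegment (x y : E) : Polytope E :=
  ⟨segment ℝ x y, {x, y}, by simp, by simp, (convexHull_pair (𝕜 := ℝ) x y).symm⟩

theorem lineSegment_comm (x y : E) : lineSegment x y = lineSegment y x :=
  toSet_injective (segment_symm ℝ x y)

/-- `P` is a weak Minkowski summand of `R` (also called a deformation of `R`): `P + Q = c R` for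
some polytope `Q` and some scalar `c ≥ 0`. -/
def IsWeakMinkowskiSummand (P R : Polytope E) : Prop :=
  ∃ (c : ℝ≥0) (Q : Polytope E), P + Q = dilate c R

end Polytope

variable (E) in
/-- Virtual polytopes: formal differences of polytopes, i.e. the Grothendieck group of the monoid
of polytopes under Minkowski addition. -/
def VirtualPolytope : Type _ := Algebra.GrothendieckAddGroup (Polytope E)

namespace VirtualPolytope

instance : AddCommGroup (VirtualPolytope E) :=
  inferInstanceAs (AddCommGroup (Algebra.GrothendieckAddGroup (Polytope E)))

/-- A polytope `P`, seen as the virtual polytope `P - {0}`. -/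
def of : Polytope E →+ VirtualPolytope E :=
  Algebra.GrothendieckAddGroup.of

theorem hom_ext {A : Type*} [AddCommGroup A] {f g : VirtualPolytope E →+ A}
    (h : ∀ P, f (of P) = g (of P)) : f = g :=
  (Algebra.GrothendieckAddGroup.lift (M := Polytope E) (G := A)).symm.injective
    (AddMonoidHom.ext h)

/-- The dilation `P - Q ↦ c P - c Q` by a scalar `c ≥ 0`. -/
def dilate (c : ℝ≥0) : VirtualPolytope E →+ VirtualPolytope E :=
  (Algebra.GrothendieckAddGroup.lift (M := Polytope E) (G := VirtualPolytope E))
    (of.comp (Polytope.dilate c))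

theorem dilate_of (c : ℝ≥0) (P : Polytope E) : dilate c (of P) = of (Polytope.dilate c P) :=
  DFunLike.congr_fun ((Algebra.GrothendieckAddGroup.lift (M := Polytope E)
    (G := VirtualPolytope E)).symm_apply_apply (of.comp (Polytope.dilate c))) P

theorem dilate_one (x : VirtualPolytope E) : dilate 1 x = x := by
  refine DFunLike.congr_fun (f := dilate 1) (g := AddMonoidHom.id _) (hom_ext fun P => ?_) x
  rw [dilate_of, AddMonoidHom.id_apply]
  exact congrArg of (Polytope.toSet_injective (by simp [Polytope.toSet_dilate]))

theorem dilate_mul (a b : ℝ≥0) (x : VirtualPolytope E) :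
    dilate (a * b) x = dilate a (dilate b x) := by
  refine DFunLike.congr_fun (f := dilate (a * b)) (g := (dilate a).comp (dilate b))
    (hom_ext fun P => ?_) x
  rw [AddMonoidHom.comp_apply, dilate_of, dilate_of, dilate_of]
  exact congrArg of (Polytope.toSet_injective (by simp [Polytope.toSet_dilate, mul_smul]))

theorem dilate_add (a b : ℝ≥0) (x : VirtualPolytope E) :
    dilate (a + b) x = dilate a x + dilate b x := by
  refine DFunLike.congr_fun (f := dilate (a + b)) (g := dilate a + dilate b)
    (hom_ext fun P => ?_) x
  rw [AddMonoidHom.add_apply, dilate_of, dilate_of, dilate_of, ← map_add]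
  exact congrArg of (Polytope.toSet_injective (P.convex.add_smul a.coe_nonneg b.coe_nonneg))

theorem dilate_zero (x : VirtualPolytope E) : dilate 0 x = 0 := by
  have h := dilate_add 0 0 x
  rw [add_zero] at h
  exact left_eq_add.1 h

/-- `r • (P - Q)` is `rP - rQ` if `r ≥ 0`, and `(-r)Q - (-r)P` if `r < 0`. -/
instance : SMul ℝ (VirtualPolytope E) :=
  ⟨fun r x => if 0 ≤ r then dilate r.toNNReal x else -dilate (-r).toNNReal x⟩

theorem smul_eq {r : ℝ} {a b : ℝ≥0} (h : r = a - b) (x : VirtualPolytope E) :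
    r • x = dilate a x - dilate b x := by
  change (if 0 ≤ r then dilate r.toNNReal x else -dilate (-r).toNNReal x) = _
  split_ifs with hr
  · rw [eq_sub_iff_add_eq, ← dilate_add]
    congr 2
    apply NNReal.eq
    rw [NNReal.coe_add, Real.coe_toNNReal _ hr, h, sub_add_cancel]
  · rw [eq_sub_iff_add_eq, neg_add_eq_iff_eq_add, ← dilate_add]
    congr 2
    apply NNReal.eq
    rw [NNReal.coe_add, Real.coe_toNNReal _ (by linarith), h]
    ring

theorem coe_smul (c : ℝ≥0) (x : VirtualPolytope E) : (c : ℝ) • x = dilate c x := by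
  rw [smul_eq (a := c) (b := 0) (by simp), dilate_zero, sub_zero]

theorem exists_eq_sub (r : ℝ) : ∃ a b : ℝ≥0, r = a - b :=
  ⟨r.toNNReal, (-r).toNNReal, by simp [Real.coe_toNNReal']⟩

instance : Module ℝ (VirtualPolytope E) where
  one_smul x := by
    rw [smul_eq (a := 1) (b := 0) (by simp), dilate_zero, sub_zero, dilate_one]
  mul_smul r s x := by
    obtain ⟨a, b, hr⟩ := exists_eq_sub r
    obtain ⟨c, d, hs⟩ := exists_eq_sub s
    have h : r * s = ((a * c + b * d : ℝ≥0) : ℝ) - ((a * d + b * c : ℝ≥0) : ℝ) := by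
      rw [hr, hs]; push_cast; ring
    rw [smul_eq h, smul_eq hs, smul_eq hr]
    simp only [dilate_add, dilate_mul, map_sub]
    abel
  smul_zero r := by
    obtain ⟨a, b, hr⟩ := exists_eq_sub r
    rw [smul_eq hr, map_zero, map_zero, sub_zero]
  smul_add r x y := by
    obtain ⟨a, b, hr⟩ := exists_eq_sub r
    simp only [smul_eq hr, map_add]
    abel
  add_smul r s x := by
    obtain ⟨a, b, hr⟩ := exists_eq_sub r
    obtain ⟨c, d, hs⟩ := exists_eq_sub s
    have h : r + s = ((a + c : ℝ≥0) : ℝ) - ((b + d : ℝ≥0) : ℝ) := by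
      rw [hr, hs]; push_cast; ring
    rw [smul_eq h, smul_eq hs, smul_eq hr]
    simp only [dilate_add]
    abel
  zero_smul x := by
    rw [smul_eq (a := 0) (b := 0) (by simp), sub_self]

end VirtualPolytope

/-! ### Deformation cones -/

/-- The deformation cone of a polytope `P`: the cone of all weak Minkowski summands of `P`, in the
real vector space of virtual polytopes. -/
def deformationCone (P : Polytope E) : PointedCone ℝ (VirtualPolytope E) where
  carrier := {x | ∃ Q : Polytope E, Q.IsWeakMinkowskiSummand P ∧ x = VirtualPolytope.of Q}
  zero_mem' := ⟨0, ⟨0, 0, Polytope.toSet_injective (by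
    rw [Polytope.toSet_dilate, NNReal.coe_zero, Set.zero_smul_set P.nonempty, add_zero,
      Polytope.toSet_zero])⟩, (map_zero _).symm⟩
  add_mem' := by
    rintro _ _ ⟨Q, ⟨a, R, h⟩, rfl⟩ ⟨Q', ⟨b, R', h'⟩, rfl⟩
    refine ⟨Q + Q', ⟨a + b, R + R', ?_⟩, (map_add _ _ _).symm⟩
    rw [add_add_add_comm, h, h']
    exact Polytope.toSet_injective (P.convex.add_smul a.coe_nonneg b.coe_nonneg).symm
  smul_mem' := by
    rintro ⟨c, hc⟩ _ ⟨Q, ⟨a, R, h⟩, rfl⟩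
    lift c to ℝ≥0 using hc
    refine ⟨Polytope.dilate c Q, ⟨c * a, Polytope.dilate c R, ?_⟩, ?_⟩
    · rw [← map_add, h]
      exact Polytope.toSet_injective (mul_smul (c : ℝ) (a : ℝ) P.toSet).symm
    · rw [← VirtualPolytope.dilate_of]
      exact VirtualPolytope.coe_smul c _

section Cones

variable {M : Type*} [AddCommGroup M] [Module ℝ M]

/-- The dimension of a cone, i.e. of its linear span (as a cardinal, so that there is no default
value for infinite dimension). -/
def coneDim (C : PointedCone ℝ M) : Cardinal :=
  Module.rank ℝ (Submodule.span ℝ (C : Set M))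

/-- The faces of a cone `C` are the zero-sets on `C` of the linear functions that are nonnegative
on `C`. -/
def IsConeFace (F C : PointedCone ℝ M) : Prop :=
  ∃ φ : M →ₗ[ℝ] ℝ, (∀ x ∈ C, 0 ≤ φ x) ∧ ∀ x, x ∈ F ↔ x ∈ C ∧ φ x = 0

/-- The facets of a cone are its faces of codimension one. -/
def coneFacets (C : PointedCone ℝ M) : Set (PointedCone ℝ M) :=
  {F | IsConeFace F C ∧ coneDim F + 1 = coneDim C}

end Cones

/-! ### Graphical zonotopes -/

section Graph

variable {V : Type*} [Fintype V] [DecidableEq V]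

/-- The segment `[e_u, e_v]` of `ℝ^V` attached to the unordered pair `{u, v}`. -/
def edgeSegment : Sym2 V → Polytope (V → ℝ) :=
  Sym2.lift ⟨fun u v => Polytope.lineSegment (Pi.single u 1) (Pi.single v 1),
    fun _ _ => Polytope.lineSegment_comm _ _⟩

/-- The graphical zonotope of `G`: the Minkowski sum of the segments `[e_u, e_v]` of `ℝ^V` over the
edges `{u, v}` of `G`. -/
def graphicalZonotope (G : SimpleGraph V) : Polytope (V → ℝ) :=
  ∑ e ∈ G.edgeSet.toFinite.toFinset, edgeSegment e

/-- The nonempty vertex sets inducing a clique. -/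
def inducedCliques (G : SimpleGraph V) : Set (Finset V) :=
  {K | K.Nonempty ∧ G.IsClique (K : Set V)}

/-- The triplets `(u, v, S)` with `{u, v}` an edge of `G` and `S ⊆ N(u) ∩ N(v)`, where the pair
`{u, v}` is unordered. -/
def facetTriplets (G : SimpleGraph V) : Set (Sym2 V × Finset V) :=
  {t | ∃ u v : V, t.1 = s(u, v) ∧ G.Adj u v ∧ (t.2 : Set V) ⊆ G.neighborSet u ∩ G.neighborSet v}

end Graph

end

noncomputable section

open scoped Pointwise NNReal

/-! ### Support functions -/

namespace Polytope

variable {V : Type*}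

theorem isCompact (P : Polytope (V → ℝ)) : IsCompact P.toSet := by
  obtain ⟨_, s, hs, _, rfl⟩ := P
  exact hs.isCompact_convexHull ℝ

variable [Fintype V]

/-- The support function `c ↦ max {c · x | x ∈ P}` of a polytope. -/
def supportFun (P : Polytope (V → ℝ)) (c : V → ℝ) : ℝ :=
  sSup ((fun x => c ⬝ᵥ x) '' P.toSet)

theorem isGreatest_supportFun (P : Polytope (V → ℝ)) (c : V → ℝ) :
    IsGreatest ((fun x => c ⬝ᵥ x) '' P.toSet) (P.supportFun c) := by
  refine (P.isCompact.image ?_).isGreatest_sSup (P.nonempty.image _)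
  exact Continuous.dotProduct continuous_const continuous_id

theorem le_supportFun {P : Polytope (V → ℝ)} {x : V → ℝ} (hx : x ∈ P.toSet) (c : V → ℝ) :
    c ⬝ᵥ x ≤ P.supportFun c :=
  (P.isGreatest_supportFun c).2 ⟨x, hx, rfl⟩

theorem exists_eq_supportFun (P : Polytope (V → ℝ)) (c : V → ℝ) :
    ∃ x ∈ P.toSet, c ⬝ᵥ x = P.supportFun c :=
  (P.isGreatest_supportFun c).1

theorem supportFun_le {P : Polytope (V → ℝ)} {c : V → ℝ} {a : ℝ}
    (h : ∀ x ∈ P.toSet, c ⬝ᵥ x ≤ a) : P.supportFun c ≤ a := by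
  obtain ⟨x, hx, hxc⟩ := P.exists_eq_supportFun c
  exact hxc ▸ h x hx

theorem supportFun_add (P Q : Polytope (V → ℝ)) (c : V → ℝ) :
    (P + Q).supportFun c = P.supportFun c + Q.supportFun c := by
  apply le_antisymm
  · refine supportFun_le fun x hx => ?_
    rw [toSet_add] at hx
    obtain ⟨p, hp, q, hq, rfl⟩ := Set.mem_add.1 hx
    rw [dotProduct_add]
    exact add_le_add (le_supportFun hp c) (le_supportFun hq c)
  · obtain ⟨p, hp, hpc⟩ := P.exists_eq_supportFun c
    obtain ⟨q, hq, hqc⟩ := Q.exists_eq_supportFun c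
    rw [← hpc, ← hqc, ← dotProduct_add]
    exact le_supportFun (by rw [toSet_add]; exact Set.add_mem_add hp hq) c

theorem supportFun_zero (c : V → ℝ) : (0 : Polytope (V → ℝ)).supportFun c = 0 := by
  obtain ⟨x, hx, hxc⟩ := (0 : Polytope (V → ℝ)).exists_eq_supportFun c
  rw [toSet_zero, Set.mem_zero] at hx
  rw [← hxc, hx, dotProduct_zero]

theorem supportFun_dilate (a : ℝ≥0) (P : Polytope (V → ℝ)) (c : V → ℝ) :
    (dilate a P).supportFun c = a * P.supportFun c := by
  apply le_antisymm
  · refine supportFun_le fun x hx => ?_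
    rw [toSet_dilate] at hx
    obtain ⟨p, hp, rfl⟩ := Set.mem_smul_set.1 hx
    rw [dotProduct_smul, smul_eq_mul]
    exact mul_le_mul_of_nonneg_left (le_supportFun hp c) a.coe_nonneg
  · obtain ⟨p, hp, hpc⟩ := P.exists_eq_supportFun c
    rw [← hpc, ← smul_eq_mul, ← dotProduct_smul]
    exact le_supportFun (by rw [toSet_dilate]; exact Set.smul_mem_smul_set hp) c

theorem supportFun_sum {ι : Type*} (s : Finset ι) (P : ι → Polytope (V → ℝ)) (c : V → ℝ) :
    (∑ i ∈ s, P i).supportFun c = ∑ i ∈ s, (P i).supportFun c := by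
  classical
  induction s using Finset.induction_on with
  | empty => simp [supportFun_zero]
  | insert i s hi ih => rw [Finset.sum_insert hi, Finset.sum_insert hi, supportFun_add, ih]

theorem supportFun_lineSegment (x y c : V → ℝ) :
    (lineSegment x y).supportFun c = max (c ⬝ᵥ x) (c ⬝ᵥ y) := by
  apply le_antisymm
  · refine supportFun_le fun z hz => ?_
    obtain ⟨a, b, ha, hb, hab, rfl⟩ : z ∈ segment ℝ x y := hz
    rw [dotProduct_add, dotProduct_smul, dotProduct_smul]
    calc a * (c ⬝ᵥ x) + b * (c ⬝ᵥ y)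
        ≤ a * max (c ⬝ᵥ x) (c ⬝ᵥ y) + b * max (c ⬝ᵥ x) (c ⬝ᵥ y) :=
          add_le_add (mul_le_mul_of_nonneg_left (le_max_left _ _) ha)
            (mul_le_mul_of_nonneg_left (le_max_right _ _) hb)
      _ = max (c ⬝ᵥ x) (c ⬝ᵥ y) := by rw [← add_mul, hab, one_mul]
  · exact max_le (le_supportFun (left_mem_segment ℝ x y) c)
      (le_supportFun (right_mem_segment ℝ x y) c)

theorem supportFun_zero_right (P : Polytope (V → ℝ)) : P.supportFun 0 = 0 := by
  obtain ⟨x, -, hxc⟩ := P.exists_eq_supportFun 0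
  rw [← hxc, zero_dotProduct]

theorem supportFun_add_le (P : Polytope (V → ℝ)) (c d : V → ℝ) :
    P.supportFun (c + d) ≤ P.supportFun c + P.supportFun d := by
  refine supportFun_le fun x hx => ?_
  rw [add_dotProduct]
  exact add_le_add (le_supportFun hx c) (le_supportFun hx d)

theorem supportFun_smul (P : Polytope (V → ℝ)) {a : ℝ} (ha : 0 ≤ a) (c : V → ℝ) :
    P.supportFun (a • c) = a * P.supportFun c := by
  apply le_antisymm
  · refine supportFun_le fun x hx => ?_
    rw [smul_dotProduct, smul_eq_mul]
    exact mul_le_mul_of_nonneg_left (le_supportFun hx c) ha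
  · obtain ⟨x, hx, hxc⟩ := P.exists_eq_supportFun c
    rw [← hxc, ← smul_eq_mul, ← smul_dotProduct]
    exact le_supportFun hx _

theorem toSet_subset_of_supportFun_le {P Q : Polytope (V → ℝ)}
    (h : ∀ c, P.supportFun c ≤ Q.supportFun c) : P.toSet ⊆ Q.toSet := by
  classical
  intro x hx
  by_contra hxQ
  obtain ⟨φ, u, hu, hux⟩ := geometric_hahn_banach_closed_point Q.convex Q.isCompact.isClosed hxQ
  have hφ : ∀ y, φ y = (fun v => φ (Pi.single v 1)) ⬝ᵥ y := by
    intro y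
    conv_lhs => rw [pi_eq_sum_univ' y]
    simp [dotProduct, mul_comm]
  obtain ⟨y, hy, hyc⟩ := Q.exists_eq_supportFun (fun v => φ (Pi.single v 1))
  have h1 := le_supportFun hx (fun v => φ (Pi.single v 1))
  have h2 := h (fun v => φ (Pi.single v 1))
  rw [← hφ] at h1 hyc
  linarith [hu y hy]

theorem supportFun_injective :
    Function.Injective (supportFun : Polytope (V → ℝ) → (V → ℝ) → ℝ) := fun _ _ h =>
  toSet_injective (Set.Subset.antisymm
    (toSet_subset_of_supportFun_le fun c => (congrFun h c).le)
    (toSet_subset_of_supportFun_le fun c => (congrFun h c).ge))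

/-- The convex hull of a nonempty finite family of points. -/
def hullRange {ι : Type*} [Finite ι] [Nonempty ι] (x : ι → V → ℝ) : Polytope (V → ℝ) :=
  ⟨convexHull ℝ (Set.range x), Set.range x, Set.finite_range x, Set.range_nonempty x, rfl⟩

theorem supportFun_hullRange {ι : Type*} [Finite ι] [Nonempty ι] (x : ι → V → ℝ) {c : V → ℝ}
    {i : ι} (h : ∀ j, c ⬝ᵥ x j ≤ c ⬝ᵥ x i) : (hullRange x).supportFun c = c ⬝ᵥ x i := by
  apply le_antisymm
  · refine supportFun_le fun y hy => ?_
    have hconv : Convex ℝ {y : V → ℝ | c ⬝ᵥ y ≤ c ⬝ᵥ x i} :=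
      convex_halfSpace_le ⟨dotProduct_add c, fun a y => dotProduct_smul a c y⟩ _
    exact convexHull_min (Set.range_subset_iff.2 h) hconv hy
  · exact le_supportFun (subset_convexHull ℝ _ (Set.mem_range_self i)) c

end Polytope

/-! ### The submodular function of a polytope -/

section

variable {V : Type*}

/-- Two vectors are comonotone if they do not order any two coordinates in opposite ways. -/
def Comonotone (c d : V → ℝ) : Prop := ∀ a b, c a < c b → d a ≤ d b

theorem Comonotone.symm {c d : V → ℝ} (h : Comonotone c d) : Comonotone d c := by
  intro a b hab
  by_contra! hc
  exact absurd (h b a hc) (not_le.2 hab)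

theorem Comonotone.smul_right {c d : V → ℝ} (h : Comonotone c d) {a : ℝ} (ha : 0 ≤ a) :
    Comonotone c (a • d) := fun x y hxy => mul_le_mul_of_nonneg_left (h x y hxy) ha

variable [DecidableEq V]

/-- The indicator vector of a vertex set. -/
def indicatorVec (S : Finset V) : V → ℝ := fun v => if v ∈ S then 1 else 0

theorem indicatorVec_empty : indicatorVec (∅ : Finset V) = 0 := by
  ext v; simp [indicatorVec]

theorem indicatorVec_insert_add {u v : V} {S : Finset V} (huv : u ≠ v) (hu : u ∉ S) (hv : v ∉ S) :
    indicatorVec (insert u (insert v S)) + indicatorVec S =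
      indicatorVec (insert u S) + indicatorVec (insert v S) := by
  ext w
  simp only [indicatorVec, Pi.add_apply, Finset.mem_insert]
  by_cases hw : w ∈ S
  · simp [hw]
  · by_cases h1 : w = u
    · subst h1; simp [huv, hu]
    · by_cases h2 : w = v
      · subst h2; simp [h1, hv]
      · simp [h1, h2, hw]

end

section

variable {V : Type*} [Fintype V]

/-- A polytope whose support function is additive on comonotone vectors. -/
def Polytope.IsComonotone (P : Polytope (V → ℝ)) : Prop :=
  ∀ c d, Comonotone c d → P.supportFun (c + d) = P.supportFun c + P.supportFun d

theorem Polytope.supportFun_neg_one {P : Polytope (V → ℝ)} (hP : P.IsComonotone) :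
    P.supportFun (-1) = - P.supportFun 1 := by
  have := hP 1 (-1) fun a b h => by simp at h
  rw [add_neg_cancel, P.supportFun_zero_right] at this
  linarith

theorem Polytope.supportFun_const {P : Polytope (V → ℝ)} (hP : P.IsComonotone) (t : ℝ) :
    P.supportFun (fun _ => t) = t * P.supportFun 1 := by
  rcases le_total 0 t with ht | ht
  · rw [← P.supportFun_smul ht]; congr 1; ext; simp
  · have : (fun _ : V => t) = (-t) • (-1 : V → ℝ) := by ext; simp
    rw [this, P.supportFun_smul (by linarith), supportFun_neg_one hP]; ring

theorem Polytope.IsComonotone.add {P Q : Polytope (V → ℝ)} (hP : P.IsComonotone)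
    (hQ : Q.IsComonotone) : (P + Q).IsComonotone := fun c d hcd => by
  rw [supportFun_add, supportFun_add, supportFun_add, hP c d hcd, hQ c d hcd]; ring

variable [DecidableEq V]

theorem indicatorVec_univ : indicatorVec (Finset.univ : Finset V) = 1 := by
  ext v; simp [indicatorVec]

theorem indicatorVec_dotProduct (S : Finset V) (x : V → ℝ) :
    indicatorVec S ⬝ᵥ x = ∑ v ∈ S, x v := by
  simp [indicatorVec, dotProduct]

/-- A comonotone additive function is determined by its values on indicator vectors. -/
theorem comonotone_induction {p : (V → ℝ) → Prop} (const : ∀ t : ℝ, p (fun _ => t))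
    (add : ∀ (c : V → ℝ) (a : ℝ) (S : Finset V), 0 ≤ a → Comonotone c (indicatorVec S) → p c →
      p (c + a • indicatorVec S)) (c : V → ℝ) : p c := by
  obtain ⟨n, hn⟩ : ∃ n, (Finset.univ.image c).card = n := ⟨_, rfl⟩
  induction n using Nat.strong_induction_on generalizing c with
  | _ n ih =>
  by_cases hconst : ∃ t, c = fun _ => t
  · obtain ⟨t, rfl⟩ := hconst
    exact const t
  have hne : (Finset.univ.image c).Nonempty := by
    by_contra h
    rw [Finset.image_nonempty, Finset.univ_nonempty_iff, not_nonempty_iff] at h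
    exact hconst ⟨0, funext fun v => h.elim v⟩
  set m := (Finset.univ.image c).max' hne with hm
  have hle : ∀ v, c v ≤ m := fun v =>
    Finset.le_max' _ _ (Finset.mem_image_of_mem c (Finset.mem_univ v))
  have hne' : ((Finset.univ.image c).erase m).Nonempty := by
    by_contra h
    rw [Finset.not_nonempty_iff_eq_empty] at h
    refine hconst ⟨m, funext fun v => ?_⟩
    by_contra hv
    have : c v ∈ (Finset.univ.image c).erase m := by simp [hv]
    simp [h] at this
  set m' := ((Finset.univ.image c).erase m).max' hne' with hm'
  have hm'mem := Finset.max'_mem _ hne'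
  rw [← hm'] at hm'mem
  obtain ⟨hm'ne, hm'im⟩ := Finset.mem_erase.1 hm'mem
  have hle' : ∀ v, c v ≠ m → c v ≤ m' := fun v hv => Finset.le_max' _ _ (by simp [hv])
  obtain ⟨w, -, hw⟩ := Finset.mem_image.1 hm'im
  have hmm' : m' < m := lt_of_le_of_ne (hw ▸ hle w) hm'ne
  have hdec : c = (fun v => min (c v) m') +
      (m - m') • indicatorVec (Finset.univ.filter fun v => c v = m) := by
    ext v
    by_cases hv : c v = m
    · simp [indicatorVec, hv, hmm'.le]
    · simp [indicatorVec, hv, hle' v hv]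
  rw [hdec]
  refine add _ _ _ (sub_nonneg.2 hmm'.le) ?_ (ih _ ?_ _ rfl)
  · apply Comonotone.symm
    intro a b hab
    by_cases hb : c b = m
    · simp only [hb, min_eq_right hmm'.le]
      exact min_le_right _ _
    · simp only [indicatorVec, Finset.mem_filter, Finset.mem_univ, true_and, hb, if_false] at hab
      split_ifs at hab <;> linarith
  · rw [← hn]
    refine (Finset.card_le_card (t := (Finset.univ.image c).erase m) fun y hy => ?_).trans_lt
      (Finset.card_erase_lt_of_mem (Finset.max'_mem _ hne))
    obtain ⟨v, -, rfl⟩ := Finset.mem_image.1 hy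
    by_cases hv : c v = m
    · simpa [hv, hmm'.le] using hm'mem
    · simp [hle' v hv, hv]

theorem Polytope.IsComonotone.ext {P Q : Polytope (V → ℝ)} (hP : P.IsComonotone)
    (hQ : Q.IsComonotone)
    (h : ∀ S, P.supportFun (indicatorVec S) = Q.supportFun (indicatorVec S)) : P = Q := by
  refine supportFun_injective (funext fun c => ?_)
  induction c using comonotone_induction with
  | const t => rw [supportFun_const hP, supportFun_const hQ, ← indicatorVec_univ, h]
  | add c a S ha hc ih =>
    have hc' : Comonotone c (a • indicatorVec S) := fun x y hxy =>
      mul_le_mul_of_nonneg_left (hc x y hxy) ha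
    rw [hP _ _ hc', hQ _ _ hc', supportFun_smul _ ha, supportFun_smul _ ha, ih, h]

end

/-! ### Base polytopes of submodular functions -/

section

variable {V : Type*} [Fintype V]

/-- The values of `c` decrease along the ordering `π`. -/
def IsSorted (c : V → ℝ) (π : V ≃ Fin (Fintype.card V)) : Prop := ∀ a b, π a ≤ π b → c b ≤ c a

theorem exists_isSorted (c : V → ℝ) : ∃ π, IsSorted c π := by
  let e := Fintype.equivFin V
  let σ := Tuple.sort (fun i => -c (e.symm i))
  refine ⟨e.trans σ.symm, fun a b hab => ?_⟩
  have := Tuple.monotone_sort (fun i => -c (e.symm i)) hab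
  simpa [σ] using this

theorem Comonotone.isSorted_left {c d : V → ℝ} (h : Comonotone c d)
    {π : V ≃ Fin (Fintype.card V)} (hπ : IsSorted (c + d) π) : IsSorted c π := by
  intro a b hab
  have h1 := hπ a b hab
  by_contra! hc
  have h2 := h a b hc
  simp only [Pi.add_apply] at h1
  linarith

theorem Comonotone.isSorted_right {c d : V → ℝ} (h : Comonotone c d)
    {π : V ≃ Fin (Fintype.card V)} (hπ : IsSorted (c + d) π) : IsSorted d π :=
  h.symm.isSorted_left (by rwa [add_comm])

end

section

variable {V : Type*} [DecidableEq V]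

/-- The second difference `f(S ∪ u) + f(S ∪ v) - f(S ∪ {u, v}) - f(S)`. -/
def secondDiff (u v : V) (S : Finset V) : (Finset V → ℝ) →ₗ[ℝ] ℝ where
  toFun f := f (insert u S) + f (insert v S) - f (insert u (insert v S)) - f S
  map_add' f g := by simp only [Pi.add_apply]; ring
  map_smul' a f := by simp only [Pi.smul_apply, smul_eq_mul, RingHom.id_apply]; ring

theorem secondDiff_apply (u v : V) (S : Finset V) (f : Finset V → ℝ) :
    secondDiff u v S f =
      f (insert u S) + f (insert v S) - f (insert u (insert v S)) - f S := rfl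

theorem secondDiff_comm (u v : V) (S : Finset V) : secondDiff u v S = secondDiff v u S := by
  ext1 f
  rw [secondDiff_apply, secondDiff_apply, Finset.insert_comm]
  ring

/-- Normalized submodular functions. -/
structure IsSubmodular (f : Finset V → ℝ) : Prop where
  map_empty : f ∅ = 0
  secondDiff_nonneg : ∀ u v S, u ≠ v → u ∉ S → v ∉ S → 0 ≤ secondDiff u v S f

theorem IsSubmodular.diminishing {f : Finset V → ℝ} (hf : IsSubmodular f) {S T : Finset V}
    (hST : S ⊆ T) {a : V} (ha : a ∉ T) : f (insert a T) - f T ≤ f (insert a S) - f S := by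
  obtain ⟨R, hR, rfl⟩ : ∃ R, Disjoint S R ∧ T = S ∪ R :=
    ⟨T \ S, Finset.disjoint_sdiff, (Finset.union_sdiff_of_subset hST).symm⟩
  clear hST
  induction R using Finset.induction_on with
  | empty => simp
  | insert b R hb ih =>
    rw [Finset.union_insert] at ha ⊢
    rw [Finset.mem_insert, not_or] at ha
    rw [Finset.disjoint_insert_right] at hR
    have h1 := ih hR.2 ha.2
    have h2 := hf.secondDiff_nonneg a b (S ∪ R) ha.1 ha.2 (by simp [hb, hR.1])
    rw [secondDiff_apply] at h2
    linarith

variable [Fintype V]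

/-- The vertex of the base polytope of `f` attached to an ordering of the ground set. -/
def greedyPoint (f : Finset V → ℝ) (π : V ≃ Fin (Fintype.card V)) : V → ℝ := fun v =>
  f (Finset.univ.filter fun w => π w ≤ π v) - f (Finset.univ.filter fun w => π w < π v)

theorem sum_greedyPoint_le {f : Finset V → ℝ} (hf : IsSubmodular f)
    (π : V ≃ Fin (Fintype.card V)) (S : Finset V) : ∑ v ∈ S, greedyPoint f π v ≤ f S := by
  induction S using Finset.induction_on_max_value π with
  | empty => simp [hf.map_empty]
  | insert a S ha hmax ih =>
    rw [Finset.sum_insert ha]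
    have hsub : S ⊆ Finset.univ.filter fun w => π w < π a := fun w hw => by
      simpa using lt_of_le_of_ne (hmax w hw) (by rintro h; exact ha (π.injective h ▸ hw))
    have h := hf.diminishing hsub (a := a) (by simp)
    have hins : insert a (Finset.univ.filter fun w => π w < π a) =
        Finset.univ.filter fun w => π w ≤ π a := by
      ext w; simp [le_iff_lt_or_eq, or_comm]
    rw [hins] at h
    rw [greedyPoint]
    linarith

theorem sum_greedyPoint_eq {f : Finset V → ℝ} (hf : IsSubmodular f)
    (π : V ≃ Fin (Fintype.card V)) (S : Finset V) (hS : ∀ a b, π a ≤ π b → b ∈ S → a ∈ S) :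
    ∑ v ∈ S, greedyPoint f π v = f S := by
  induction S using Finset.induction_on_max_value π with
  | empty => simp [hf.map_empty]
  | insert a S ha hmax ih =>
    have hlt : ∀ w ∈ S, π w < π a := fun w hw =>
      lt_of_le_of_ne (hmax w hw) (by rintro h; exact ha (π.injective h ▸ hw))
    have hS' : S = Finset.univ.filter fun w => π w < π a := by
      ext w
      simp only [Finset.mem_filter, Finset.mem_univ, true_and]
      refine ⟨hlt w, fun hw => ?_⟩
      exact Finset.mem_of_mem_insert_of_ne (hS w a hw.le (Finset.mem_insert_self a S))
        (by rintro rfl; exact lt_irrefl _ hw)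
    have hins : insert a S = Finset.univ.filter fun w => π w ≤ π a := by
      rw [hS']
      ext w; simp [le_iff_lt_or_eq, or_comm]
    rw [Finset.sum_insert ha, ih, greedyPoint, ← hins, ← hS']
    · ring
    · intro x y hxy hy
      refine Finset.mem_of_mem_insert_of_ne (hS x y hxy (Finset.mem_insert_of_mem hy)) ?_
      rintro rfl
      exact absurd (hlt y hy) (not_lt.2 hxy)

theorem IsSorted.mem_of_le {S : Finset V} {π : V ≃ Fin (Fintype.card V)}
    (h : IsSorted (indicatorVec S) π) : ∀ a b, π a ≤ π b → b ∈ S → a ∈ S := by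
  intro a b hab hb
  by_contra ha
  have := h a b hab
  simp only [indicatorVec, hb, ha, if_true, if_false] at this
  linarith

theorem dotProduct_le_greedyPoint {f : Finset V → ℝ} (hf : IsSubmodular f) {y : V → ℝ}
    (hy : ∀ S, ∑ v ∈ S, y v ≤ f S) (hy' : ∑ v, y v = f Finset.univ) {c : V → ℝ}
    {σ : V ≃ Fin (Fintype.card V)} (hσ : IsSorted c σ) : c ⬝ᵥ y ≤ c ⬝ᵥ greedyPoint f σ := by
  induction c using comonotone_induction with
  | const t =>
    simp only [dotProduct, ← Finset.mul_sum]
    rw [hy', sum_greedyPoint_eq hf σ _ (by simp)]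
  | add c a S ha hc ih =>
    rcases ha.eq_or_lt with rfl | ha'
    · rw [zero_smul, add_zero] at hσ ⊢
      exact ih hσ
    have hS : IsSorted (indicatorVec S) σ := fun x y hxy => by
      have := (hc.smul_right ha).isSorted_right hσ x y hxy
      exact le_of_mul_le_mul_left this ha'
    have h1 := ih ((hc.smul_right ha).isSorted_left hσ)
    rw [add_dotProduct, add_dotProduct, smul_dotProduct, smul_dotProduct,
      indicatorVec_dotProduct, indicatorVec_dotProduct, sum_greedyPoint_eq hf σ S hS.mem_of_le]
    exact add_le_add h1 (mul_le_mul_of_nonneg_left (hy S) ha)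

instance : Nonempty (V ≃ Fin (Fintype.card V)) := ⟨Fintype.equivFin V⟩

/-- The base polytope of a submodular function. -/
def basePolytope (f : Finset V → ℝ) : Polytope (V → ℝ) := Polytope.hullRange (greedyPoint f)

theorem supportFun_basePolytope {f : Finset V → ℝ} (hf : IsSubmodular f) {c : V → ℝ}
    {σ : V ≃ Fin (Fintype.card V)} (hσ : IsSorted c σ) :
    (basePolytope f).supportFun c = c ⬝ᵥ greedyPoint f σ :=
  Polytope.supportFun_hullRange _ fun π =>
    dotProduct_le_greedyPoint hf (sum_greedyPoint_le hf π)
      (sum_greedyPoint_eq hf π _ (by simp)) hσ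

theorem basePolytope_isComonotone {f : Finset V → ℝ} (hf : IsSubmodular f) :
    (basePolytope f).IsComonotone := by
  intro c d hcd
  obtain ⟨σ, hσ⟩ := exists_isSorted (c + d)
  rw [supportFun_basePolytope hf hσ, supportFun_basePolytope hf (hcd.isSorted_left hσ),
    supportFun_basePolytope hf (hcd.isSorted_right hσ), add_dotProduct]

theorem supportFun_basePolytope_indicatorVec {f : Finset V → ℝ} (hf : IsSubmodular f)
    (S : Finset V) : (basePolytope f).supportFun (indicatorVec S) = f S := by
  obtain ⟨σ, hσ⟩ := exists_isSorted (indicatorVec S)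
  rw [supportFun_basePolytope hf hσ, indicatorVec_dotProduct,
    sum_greedyPoint_eq hf σ S hσ.mem_of_le]

end

/-! ### Facets of polyhedral cones -/

theorem exists_pos_forall_le_mul {ι : Type*} (T : Finset ι) (a b : ι → ℝ)
    (hb : ∀ t ∈ T, 0 < b t) : ∃ r : ℝ, 0 < r ∧ ∀ t ∈ T, a t ≤ r * b t := by
  have h1 : ∀ᶠ r : ℝ in Filter.atTop, ∀ t ∈ T, a t ≤ r * b t := by
    rw [Filter.eventually_all_finset]
    intro t ht
    exact (Filter.tendsto_id.atTop_mul_const (hb t ht)).eventually_ge_atTop (a t)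
  exact ((Filter.eventually_gt_atTop 0).and h1).exists

section

variable {M : Type*} [AddCommGroup M] [Module ℝ M]

theorem mem_span_pointedCone {C : PointedCone ℝ M} {x : M} (hx : x ∈ Submodule.span ℝ (C : Set M)) : ∃ y ∈ C, ∃ z ∈ C, x = y - z := by
  induction hx using Submodule.span_induction with
  | mem x hx => exact ⟨x, hx, 0, zero_mem _, (sub_zero x).symm⟩
  | zero => exact ⟨0, zero_mem _, 0, zero_mem _, (sub_zero 0).symm⟩
  | add x x' _ _ h h' =>
    obtain ⟨y, hy, z, hz, rfl⟩ := h
    obtain ⟨y', hy', z', hz', rfl⟩ := h'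
    exact ⟨y + y', add_mem hy hy', z + z', add_mem hz hz', by abel⟩
  | smul a x _ h =>
    obtain ⟨y, hy, z, hz, rfl⟩ := h
    rcases le_total 0 a with ha | ha
    · exact ⟨a • y, PointedCone.smul_mem C ha hy, a • z, PointedCone.smul_mem C ha hz, smul_sub a y z⟩
    · refine ⟨(-a) • z, PointedCone.smul_mem C (neg_nonneg.2 ha) hz, (-a) • y,
        PointedCone.smul_mem C (neg_nonneg.2 ha) hy, ?_⟩
      rw [smul_sub, neg_smul, neg_smul]
      abel

theorem finrank_inf_ker_add_one (L : Submodule ℝ M) [FiniteDimensional ℝ L] (φ : M →ₗ[ℝ] ℝ)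
    {z : M} (hz : z ∈ L) (hφ : φ z ≠ 0) :
    Module.finrank ℝ ↥(L ⊓ LinearMap.ker φ) + 1 = Module.finrank ℝ L := by
  have hne : φ.domRestrict L ≠ 0 := fun h => hφ (LinearMap.congr_fun h ⟨z, hz⟩)
  rw [← Module.Dual.finrank_ker_add_one_of_ne_zero (f := φ.domRestrict L) hne,
    ← Submodule.map_comap_subtype, Submodule.finrank_map_subtype_eq]
  rfl

theorem coneDim_eq_finrank {C : PointedCone ℝ M}
    [FiniteDimensional ℝ (Submodule.span ℝ (C : Set M))] :
    coneDim C = (Module.finrank ℝ (Submodule.span ℝ (C : Set M)) : Cardinal) :=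
  (Module.finrank_eq_rank ℝ _).symm

variable {ι : Type*} {C : PointedCone ℝ M} {ℓ : ι → M →ₗ[ℝ] ℝ} {T : Finset ι}

theorem mem_coneFacets_of_ker (t : ι) (ht : t ∈ T)
    [FiniteDimensional ℝ (Submodule.span ℝ (C : Set M))]
    (hC : ∀ x, x ∈ C ↔ x ∈ Submodule.span ℝ (C : Set M) ∧ ∀ t ∈ T, 0 ≤ ℓ t x)
    {z : M} (hz : z ∈ Submodule.span ℝ (C : Set M)) (hzT : ∀ t ∈ T, 0 < ℓ t z)
    {x : M} (hx : x ∈ Submodule.span ℝ (C : Set M)) (hxt : ℓ t x = 0)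
    (hxT : ∀ s ∈ T, s ≠ t → 0 < ℓ s x) :
    C ⊓ PointedCone.ofSubmodule (LinearMap.ker (ℓ t)) ∈ coneFacets C := by
  classical
  have hspan : Submodule.span ℝ ((C ⊓ PointedCone.ofSubmodule (LinearMap.ker (ℓ t)) :
      PointedCone ℝ M) : Set M) = Submodule.span ℝ (C : Set M) ⊓ LinearMap.ker (ℓ t) := by
    apply le_antisymm
    · rw [Submodule.span_le]
      exact fun y hy => ⟨Submodule.subset_span hy.1, hy.2⟩
    · rintro y ⟨hyL, hyt⟩
      replace hyt : ℓ t y = 0 := hyt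
      have hxF : x ∈ (C ⊓ PointedCone.ofSubmodule (LinearMap.ker (ℓ t)) : PointedCone ℝ M) := by
        refine ⟨(hC x).2 ⟨hx, fun s hs => ?_⟩, hxt⟩
        by_cases hst : s = t
        · rw [hst, hxt]
        · exact (hxT s hs hst).le
      obtain ⟨r, hr, hrT⟩ := exists_pos_forall_le_mul (T.erase t) (fun s => -ℓ s y)
        (fun s => ℓ s x) fun s hs => hxT s (Finset.mem_of_mem_erase hs) (Finset.ne_of_mem_erase hs)
      have hyF : y + r • x ∈
          (C ⊓ PointedCone.ofSubmodule (LinearMap.ker (ℓ t)) : PointedCone ℝ M) := by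
        have h0 : ℓ t (y + r • x) = 0 := by simp [hyt, hxt]
        refine ⟨(hC _).2 ⟨add_mem hyL (Submodule.smul_mem _ _ hx), fun s hs => ?_⟩, h0⟩
        by_cases hst : s = t
        · rw [hst, h0]
        · have := hrT s (Finset.mem_erase.2 ⟨hst, hs⟩)
          rw [map_add, map_smul, smul_eq_mul]
          linarith
      have := sub_mem (Submodule.subset_span (R := ℝ) hyF)
        (Submodule.smul_mem _ r (Submodule.subset_span (R := ℝ) hxF))
      rwa [add_sub_cancel_right] at this
  refine ⟨⟨ℓ t, fun y hy => ((hC y).1 hy).2 t ht, fun y => Iff.rfl⟩, ?_⟩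
  rw [coneDim_eq_finrank (C := C), ← finrank_inf_ker_add_one _ (ℓ t) hz (hzT t ht).ne', coneDim, hspan,
    ← Module.finrank_eq_rank, Nat.cast_add, Nat.cast_one]

theorem exists_eq_of_mem_coneFacets
    [FiniteDimensional ℝ (Submodule.span ℝ (C : Set M))]
    (hC : ∀ x, x ∈ C ↔ x ∈ Submodule.span ℝ (C : Set M) ∧ ∀ t ∈ T, 0 ≤ ℓ t x)
    {z : M} (hz : z ∈ Submodule.span ℝ (C : Set M)) (hzT : ∀ t ∈ T, 0 < ℓ t z)
    {F : PointedCone ℝ M} (hF : F ∈ coneFacets C) :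
    ∃ t ∈ T, C ⊓ PointedCone.ofSubmodule (LinearMap.ker (ℓ t)) = F := by
  obtain ⟨⟨φ, hφ, hFφ⟩, hdim⟩ := hF
  have hFC : ∀ x ∈ F, x ∈ C := fun x hx => ((hFφ x).1 hx).1
  have hle : Submodule.span ℝ (F : Set M) ≤ Submodule.span ℝ (C : Set M) :=
    Submodule.span_mono hFC
  have : FiniteDimensional ℝ (Submodule.span ℝ (F : Set M)) :=
    Submodule.finiteDimensional_of_le hle
  rw [coneDim_eq_finrank, coneDim_eq_finrank] at hdim
  replace hdim : Module.finrank ℝ (Submodule.span ℝ (F : Set M)) + 1 =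
      Module.finrank ℝ (Submodule.span ℝ (C : Set M)) := by exact_mod_cast hdim
  obtain ⟨t, ht, htF⟩ : ∃ t ∈ T, ∀ x ∈ F, ℓ t x = 0 := by
    by_contra! h
    choose! y hyF hy using h
    have hyT : ∀ t ∈ T, ∀ s ∈ T, 0 ≤ ℓ t (y s) := fun t ht s hs =>
      ((hC _).1 (hFC _ (hyF s hs))).2 t ht
    have hwF : ∑ s ∈ T, y s ∈ F := sum_mem hyF
    have hwT : ∀ t ∈ T, 0 < ℓ t (∑ s ∈ T, y s) := fun t ht => by
      rw [map_sum]
      exact Finset.sum_pos' (hyT t ht) ⟨t, ht, lt_of_le_of_ne (hyT t ht t ht) (hy t ht).symm⟩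
    have hCF : F = C := by
      refine le_antisymm hFC fun x hx => (hFφ x).2 ⟨hx, le_antisymm ?_ (hφ x hx)⟩
      obtain ⟨r, hr, hrT⟩ := exists_pos_forall_le_mul T (fun t => ℓ t x) _ hwT
      have hmem : r • (∑ s ∈ T, y s) - x ∈ C := by
        refine (hC _).2 ⟨sub_mem (Submodule.smul_mem _ _ (Submodule.subset_span (hFC _ hwF)))
          (Submodule.subset_span hx), fun t ht => ?_⟩
        rw [map_sub, map_smul, smul_eq_mul]
        linarith [hrT t ht]
      have h1 := hφ _ hmem
      rw [map_sub, map_smul, ((hFφ _).1 hwF).2, smul_zero] at h1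
      linarith
    rw [hCF] at hdim
    omega
  have hspan : Submodule.span ℝ (F : Set M) =
      Submodule.span ℝ (C : Set M) ⊓ LinearMap.ker (ℓ t) := by
    refine Submodule.eq_of_le_of_finrank_eq (le_inf hle (Submodule.span_le.2 htF)) ?_
    have := finrank_inf_ker_add_one _ (ℓ t) hz (hzT t ht).ne'
    omega
  have hφF : Submodule.span ℝ (F : Set M) ≤ LinearMap.ker φ :=
    Submodule.span_le.2 fun x hx => ((hFφ x).1 hx).2
  refine ⟨t, ht, le_antisymm (fun x hx => (hFφ x).2 ⟨hx.1, hφF ?_⟩) fun x hx =>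
    ⟨hFC x hx, htF x hx⟩⟩
  rw [hspan]
  exact ⟨Submodule.subset_span hx.1, hx.2⟩

/-- The facets of a cone given by an irredundant finite system of linear inequalities correspond
to the inequalities. -/
theorem encard_coneFacets [FiniteDimensional ℝ (Submodule.span ℝ (C : Set M))]
    (hC : ∀ x, x ∈ C ↔ x ∈ Submodule.span ℝ (C : Set M) ∧ ∀ t ∈ T, 0 ≤ ℓ t x)
    {z : M} (hz : z ∈ Submodule.span ℝ (C : Set M)) (hzT : ∀ t ∈ T, 0 < ℓ t z)
    (hT : ∀ t ∈ T, ∃ x ∈ Submodule.span ℝ (C : Set M), ℓ t x = 0 ∧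
      ∀ s ∈ T, s ≠ t → 0 < ℓ s x) :
    (coneFacets C).encard = (T : Set ι).encard := by
  have himage : coneFacets C =
      (fun t => C ⊓ PointedCone.ofSubmodule (LinearMap.ker (ℓ t))) '' (T : Set ι) := by
    ext F
    constructor
    · exact fun hF => exists_eq_of_mem_coneFacets hC hz hzT hF
    · rintro ⟨t, ht, rfl⟩
      obtain ⟨x, hx, hxt, hxT⟩ := hT t ht
      exact mem_coneFacets_of_ker t ht hC hz hzT hx hxt hxT
  rw [himage, Set.InjOn.encard_image]
  intro s hs t ht hst
  obtain ⟨x, hx, hxt, hxT⟩ := hT t ht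
  by_contra hne
  have hxF : x ∈ C ⊓ PointedCone.ofSubmodule (LinearMap.ker (ℓ t)) := by
    refine ⟨(hC x).2 ⟨hx, fun r hr => ?_⟩, hxt⟩
    by_cases hrt : r = t
    · rw [hrt, hxt]
    · exact (hxT r hr hrt).le
  have hxs : ℓ s x = 0 := by
    change (fun t => C ⊓ PointedCone.ofSubmodule (LinearMap.ker (ℓ t))) s =
      (fun t => C ⊓ PointedCone.ofSubmodule (LinearMap.ker (ℓ t))) t at hst
    simp only at hst
    rw [← hst] at hxF
    exact hxF.2
  exact (hxT s hs hne).ne' hxs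

end

/-! ### Submodular functions supported on the cliques of a graph -/

section

variable {V : Type*} [Fintype V] {G : SimpleGraph V}

variable (G) in
/-- The finite set of facet triplets. -/
def tripletFinset : Finset (Sym2 V × Finset V) := (facetTriplets G).toFinite.toFinset

theorem coe_tripletFinset : (tripletFinset G : Set (Sym2 V × Finset V)) = facetTriplets G := by
  simp [tripletFinset]

theorem mem_tripletFinset {t : Sym2 V × Finset V} : t ∈ tripletFinset G ↔
    ∃ u v S, t = (s(u, v), S) ∧ G.Adj u v ∧ ∀ w ∈ S, G.Adj u w ∧ G.Adj v w := by
  rw [tripletFinset, Set.Finite.mem_toFinset]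
  constructor
  · rintro ⟨u, v, h1, h2, h3⟩
    exact ⟨u, v, t.2, Prod.ext h1 rfl, h2, fun w hw => h3 hw⟩
  · rintro ⟨u, v, S, rfl, h2, h3⟩
    exact ⟨u, v, rfl, h2, fun w hw => h3 w hw⟩

end

section

variable {V : Type*} [DecidableEq V]

/-- The set functions vanishing on `∅` that are modular with respect to nonadjacent pairs. -/
def cliqueSpace (G : SimpleGraph V) : Submodule ℝ (Finset V → ℝ) where
  carrier := {f | f ∅ = 0 ∧ ∀ u v S, u ≠ v → ¬ G.Adj u v → u ∉ S → v ∉ S → secondDiff u v S f = 0}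
  zero_mem' := ⟨rfl, fun _ _ _ _ _ _ _ => map_zero _⟩
  add_mem' := fun hf hg => ⟨by simp [hf.1, hg.1], fun u v S h1 h2 h3 h4 => by
    rw [map_add, hf.2 u v S h1 h2 h3 h4, hg.2 u v S h1 h2 h3 h4, add_zero]⟩
  smul_mem' := fun a f hf => ⟨by simp [hf.1], fun u v S h1 h2 h3 h4 => by
    rw [map_smul, hf.2 u v S h1 h2 h3 h4, smul_zero]⟩

variable {G : SimpleGraph V}

theorem secondDiff_insert {f : Finset V → ℝ} (hf : f ∈ cliqueSpace G) {u v w : V} {S : Finset V}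
    (huv : u ≠ v) (huw : u ≠ w) (hvw : v ≠ w) (hu : u ∉ S) (hw : w ∉ S)
    (h : ¬ G.Adj u w) : secondDiff u v (insert w S) f = secondDiff u v S f := by
  have h1 := hf.2 u w S huw h hu hw
  have h2 := hf.2 u w (insert v S) huw h (by simp [huv, hu]) (by simp [hvw.symm, hw])
  rw [secondDiff_apply] at h1 h2 ⊢
  rw [secondDiff_apply]
  rw [Finset.insert_comm w v S] at h2
  linarith

theorem secondDiff_union {f : Finset V → ℝ} (hf : f ∈ cliqueSpace G) {u v : V}
    (huv : u ≠ v) {S R : Finset V} (hR : Disjoint S R) (hu : u ∉ S ∪ R) (hv : v ∉ S ∪ R)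
    (h : ∀ w ∈ R, ¬ (G.Adj u w ∧ G.Adj v w)) :
    secondDiff u v (S ∪ R) f = secondDiff u v S f := by
  induction R using Finset.induction_on with
  | empty => simp
  | insert w R hw ih =>
    rw [Finset.disjoint_insert_right] at hR
    rw [Finset.union_insert, Finset.mem_insert, not_or] at hu hv
    have hw' : w ∉ S ∪ R := by simp [hw, hR.1]
    rw [Finset.union_insert, ← ih hR.2 hu.2 hv.2 fun x hx => h x (Finset.mem_insert_of_mem hx)]
    rcases not_and_or.1 (h w (Finset.mem_insert_self w R)) with h | h
    · exact secondDiff_insert hf huv hu.1 hv.1 hu.2 hw' h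
    · rw [secondDiff_comm, secondDiff_insert hf huv.symm hv.1 hu.1 hv.2 hw' h, secondDiff_comm]

open Classical in
theorem secondDiff_filter {f : Finset V → ℝ} (hf : f ∈ cliqueSpace G) {u v : V}
    (huv : u ≠ v) {S : Finset V} (hu : u ∉ S) (hv : v ∉ S) :
    secondDiff u v (S.filter fun w => G.Adj u w ∧ G.Adj v w) f = secondDiff u v S f := by
  have hS := Finset.filter_union_filter_not_eq (fun w => G.Adj u w ∧ G.Adj v w) S
  conv_rhs => rw [← hS]
  refine (secondDiff_union hf huv (Finset.disjoint_filter_filter_not _ _ _) ?_ ?_ ?_).symm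
  · rwa [hS]
  · rwa [hS]
  · intro w hw
    exact (Finset.mem_filter.1 hw).2

/-- The evaluation of the second difference attached to an unordered pair. -/
def pairDiff (t : Sym2 V × Finset V) : (Finset V → ℝ) →ₗ[ℝ] ℝ :=
  Sym2.lift ⟨fun u v => secondDiff u v t.2, fun u v => secondDiff_comm u v t.2⟩ t.1

theorem pairDiff_mk (u v : V) (S : Finset V) : pairDiff (s(u, v), S) = secondDiff u v S := rfl

section

variable [Fintype V]

/-- An element of `cliqueSpace G` is submodular as soon as the second differences attached to the
facet triplets are nonnegative. -/
theorem isSubmodular_of_pairDiff_nonneg {f : Finset V → ℝ} (hf : f ∈ cliqueSpace G)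
    (h : ∀ t ∈ tripletFinset G, 0 ≤ pairDiff t f) : IsSubmodular f where
  map_empty := hf.1
  secondDiff_nonneg u v S huv hu hv := by
    classical
    by_cases hadj : G.Adj u v
    · rw [← secondDiff_filter hf huv hu hv]
      exact h (s(u, v), _) (mem_tripletFinset.2
        ⟨u, v, _, rfl, hadj, fun w hw => (Finset.mem_filter.1 hw).2⟩)
    · exact (hf.2 u v S huv hadj hu hv).ge

theorem IsSubmodular.pairDiff_nonneg {f : Finset V → ℝ} (hf : IsSubmodular f)
    {t : Sym2 V × Finset V} (ht : t ∈ tripletFinset G) : 0 ≤ pairDiff t f := by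
  obtain ⟨u, v, S, rfl, hadj, hS⟩ := mem_tripletFinset.1 ht
  exact hf.secondDiff_nonneg u v S hadj.ne (fun h => (hS u h).1.ne rfl) fun h => (hS v h).2.ne rfl

end

theorem IsSubmodular.eq_sum {f : Finset V → ℝ} (hf : IsSubmodular f) (hf' : IsSubmodular (-f))
    (S : Finset V) : f S = ∑ v ∈ S, f {v} := by
  induction S using Finset.induction_on with
  | empty => simp [hf.map_empty]
  | insert a S ha ih =>
    have h1 := hf.diminishing (Finset.empty_subset S) ha
    have h2 := hf'.diminishing (Finset.empty_subset S) ha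
    simp only [Pi.neg_apply, hf.map_empty, insert_empty_eq] at h1 h2
    rw [Finset.sum_insert ha, ← ih]
    linarith

theorem secondDiff_sum_eq_zero (y : V → ℝ) {u v : V} {S : Finset V} (huv : u ≠ v) (hu : u ∉ S)
    (hv : v ∉ S) : secondDiff u v S (fun S => ∑ w ∈ S, y w) = 0 := by
  rw [secondDiff_apply, Finset.sum_insert hu, Finset.sum_insert hv,
    Finset.sum_insert (by simp [huv, hu]), Finset.sum_insert hv]
  ring

theorem sum_mem_cliqueSpace (y : V → ℝ) : (fun S => ∑ w ∈ S, y w) ∈ cliqueSpace G :=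
  ⟨by simp, fun _ _ _ h1 _ h3 h4 => secondDiff_sum_eq_zero y h1 h3 h4⟩

/-! ### The dimension of the clique space -/

theorem eq_zero_of_forall_isClique {f : Finset V → ℝ} (hf : f ∈ cliqueSpace G)
    (h : ∀ K ∈ inducedCliques G, f K = 0) : f = 0 := by
  funext S
  induction S using Finset.strongInduction with
  | H S ih =>
  rcases S.eq_empty_or_nonempty with rfl | hne
  · exact hf.1
  by_cases hS : G.IsClique (S : Set V)
  · exact h S ⟨hne, hS⟩
  · simp only [SimpleGraph.IsClique, Set.Pairwise] at hS
    push Not at hS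
    obtain ⟨u, hu, v, hv, huv, hadj⟩ := hS
    rw [Finset.mem_coe] at hu hv
    have h1 := hf.2 u v ((S.erase u).erase v) huv hadj (by simp) (by simp)
    have hv' : v ∈ S.erase u := Finset.mem_erase.2 ⟨huv.symm, hv⟩
    have hu' : u ∈ S.erase v := Finset.mem_erase.2 ⟨huv, hu⟩
    rw [secondDiff_apply, Finset.insert_erase hv', Finset.insert_erase hu,
      Finset.erase_right_comm, Finset.insert_erase hu', ih _ (Finset.erase_ssubset hu),
      ih _ (Finset.erase_ssubset hv),
      ih _ ((Finset.erase_ssubset hu').trans (Finset.erase_ssubset hv))] at h1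
    simp only [Pi.zero_apply] at h1 ⊢
    linarith

/-- The indicator function of the supersets of a set. -/
def supersetFun (K : Finset V) : Finset V → ℝ := fun S => if K ⊆ S then 1 else 0

theorem supersetFun_mem {K : Finset V} (hK : K ∈ inducedCliques G) :
    supersetFun K ∈ cliqueSpace G := by
  refine ⟨?_, fun u v S huv hadj hu hv => ?_⟩
  · simp [supersetFun, hK.1.ne_empty]
  · have hnot : ¬ (u ∈ K ∧ v ∈ K) := fun h => hadj (hK.2 h.1 h.2 huv)
    rw [secondDiff_apply]
    rcases not_and_or.1 hnot with h | h
    · simp only [supersetFun, Finset.subset_insert_iff_of_notMem h]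
      ring
    · rw [Finset.insert_comm]
      simp only [supersetFun, Finset.subset_insert_iff_of_notMem h]
      ring

section

variable [Fintype V]

instance : Finite (inducedCliques G) := (Set.toFinite _)

theorem linearIndependent_supersetFun :
    LinearIndependent ℝ fun K : inducedCliques G =>
      (⟨supersetFun K.1, supersetFun_mem K.2⟩ : cliqueSpace G) := by
  have := Fintype.ofFinite (inducedCliques G)
  rw [Fintype.linearIndependent_iff]
  intro a ha
  have key : ∀ (K : Finset V) (hK : K ∈ inducedCliques G), a ⟨K, hK⟩ = 0 := by
    intro K
    induction K using Finset.strongInduction with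
    | H K ih =>
    intro hK
    have h1 := congrFun (congrArg Subtype.val ha) K
    rw [AddSubmonoidClass.coe_finsetSum, Finset.sum_apply,
      Finset.sum_eq_single (⟨K, hK⟩ : inducedCliques G)] at h1
    · simpa [supersetFun] using h1
    · rintro ⟨L, hL⟩ - hne
      by_cases hLK : L ⊆ K
      · rw [ih L (hLK.ssubset_of_ne fun h => hne (Subtype.ext h)) hL, zero_smul]
        rfl
      · simp [supersetFun, hLK]
    · simp
  exact fun K => key K.1 K.2

theorem finrank_cliqueSpace : Module.finrank ℝ (cliqueSpace G) = (inducedCliques G).ncard := by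
  have := Fintype.ofFinite (inducedCliques G)
  rw [← Nat.card_coe_set_eq, Nat.card_eq_fintype_card]
  apply le_antisymm
  · rw [← Module.finrank_fintype_fun_eq_card ℝ (η := inducedCliques G)]
    refine LinearMap.finrank_le_finrank_of_injective
      (f := ((LinearMap.funLeft ℝ ℝ (Subtype.val : inducedCliques G → Finset V)).comp
        (cliqueSpace G).subtype)) ?_
    rw [← LinearMap.ker_eq_bot, LinearMap.ker_eq_bot']
    intro f hf
    exact Subtype.ext (eq_zero_of_forall_isClique f.2 fun K hK => congrFun hf ⟨K, hK⟩)
  · exact linearIndependent_supersetFun.fintype_card_le_finrank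

end

end

/-! ### The support function of the graphical zonotope -/

section

variable {V : Type*} [Fintype V] [DecidableEq V]

theorem supportFun_edgeSegment (u v : V) (c : V → ℝ) :
    (edgeSegment s(u, v)).supportFun c = max (c u) (c v) := by
  rw [edgeSegment, Sym2.lift_mk]
  simp [Polytope.supportFun_lineSegment]

theorem supportFun_graphicalZonotope (G : SimpleGraph V) (c : V → ℝ) :
    (graphicalZonotope G).supportFun c =
      ∑ e ∈ G.edgeSet.toFinite.toFinset, (edgeSegment e).supportFun c :=
  Polytope.supportFun_sum _ _ _

theorem max_add_max_of_comonotone {a b c d : ℝ} (h : a < b → c ≤ d) (h' : b < a → d ≤ c) :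
    max (a + c) (b + d) = max a b + max c d := by
  rcases lt_trichotomy a b with hab | rfl | hab
  · have := h hab
    rw [max_eq_right hab.le, max_eq_right this, max_eq_right (by linarith)]
  · rw [max_self, max_add_add_left]
  · have := h' hab
    rw [max_eq_left hab.le, max_eq_left this, max_eq_left (by linarith)]

theorem supportFun_graphicalZonotope_add (G : SimpleGraph V) {c d : V → ℝ}
    (h : ∀ u v, G.Adj u v → c u < c v → d u ≤ d v) :
    (graphicalZonotope G).supportFun (c + d) =
      (graphicalZonotope G).supportFun c + (graphicalZonotope G).supportFun d := by
  simp only [supportFun_graphicalZonotope, ← Finset.sum_add_distrib]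
  refine Finset.sum_congr rfl fun e he => ?_
  induction e using Sym2.ind with
  | _ u v =>
  have hadj : G.Adj u v := by simpa using he
  simp only [supportFun_edgeSegment, Pi.add_apply]
  exact max_add_max_of_comonotone (h u v hadj) (h v u hadj.symm)

/-- The submodular function of the graphical zonotope. -/
def zonotopeFun (G : SimpleGraph V) : Finset V → ℝ := fun S =>
  (graphicalZonotope G).supportFun (indicatorVec S)

theorem secondDiff_edgeSegment {u v : V} {S : Finset V} (huv : u ≠ v) (hu : u ∉ S) (hv : v ∉ S)
    (e : Sym2 V) : secondDiff u v S (fun S => (edgeSegment e).supportFun (indicatorVec S)) =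
      if e = s(u, v) then 1 else 0 := by
  induction e using Sym2.ind with
  | _ a b =>
  simp only [secondDiff_apply, supportFun_edgeSegment, indicatorVec, Finset.mem_insert,
    Sym2.eq_iff]
  by_cases ha : a ∈ S
  · have h1 : a ≠ u := by rintro rfl; exact hu ha
    have h2 : a ≠ v := by rintro rfl; exact hv ha
    simp only [ha, h1, h2]
    split_ifs <;> simp_all
  by_cases hb : b ∈ S
  · have h1 : b ≠ u := by rintro rfl; exact hu hb
    have h2 : b ≠ v := by rintro rfl; exact hv hb
    simp only [hb, h1, h2]
    split_ifs <;> simp_all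
  simp only [ha, hb, or_false]
  by_cases hau : a = u <;> by_cases hav : a = v <;> by_cases hbu : b = u <;>
    by_cases hbv : b = v <;> simp_all

theorem secondDiff_zonotopeFun (G : SimpleGraph V) [DecidableRel G.Adj] {u v : V} {S : Finset V}
    (huv : u ≠ v) (hu : u ∉ S) (hv : v ∉ S) :
    secondDiff u v S (zonotopeFun G) = if G.Adj u v then 1 else 0 := by
  have h : zonotopeFun G = ∑ e ∈ G.edgeSet.toFinite.toFinset,
      fun S => (edgeSegment e).supportFun (indicatorVec S) := by
    ext S
    rw [zonotopeFun, supportFun_graphicalZonotope, Finset.sum_apply]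
  rw [h, map_sum, Finset.sum_congr rfl fun e _ => secondDiff_edgeSegment huv hu hv e,
    Finset.sum_ite_eq']
  simp

theorem zonotopeFun_mem (G : SimpleGraph V) : zonotopeFun G ∈ cliqueSpace G := by
  classical
  refine ⟨?_, fun u v S huv hadj hu hv => ?_⟩
  · rw [zonotopeFun, indicatorVec_empty, Polytope.supportFun_zero_right]
  · rw [secondDiff_zonotopeFun G huv hu hv, if_neg hadj]

theorem pairDiff_zonotopeFun {G : SimpleGraph V} {t : Sym2 V × Finset V}
    (ht : t ∈ tripletFinset G) : pairDiff t (zonotopeFun G) = 1 := by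
  classical
  obtain ⟨u, v, S, rfl, hadj, hS⟩ := mem_tripletFinset.1 ht
  rw [pairDiff_mk, secondDiff_zonotopeFun G hadj.ne (fun h => (hS u h).1.ne rfl)
    (fun h => (hS v h).2.ne rfl), if_pos hadj]

end

/-! ### Irredundancy of the facet inequalities -/

section

variable {V : Type*} [DecidableEq V]

/-- The coefficients of the linear form on `S'` which counts the symmetric difference of `S` and
`S'` among the common neighbours of `u` and `v`, up to a constant. -/
def triangleWeight (G : SimpleGraph V) [DecidableRel G.Adj] (u v : V) (S : Finset V) (w : V) : ℝ :=
  if w ∈ S then -1 else if G.Adj u w ∧ G.Adj v w then 1 else 0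

/-- The correction subtracted from `2 • zonotopeFun G` in `facetWitness`. -/
def facetCorrection (G : SimpleGraph V) [DecidableRel G.Adj] (u v : V) (S X : Finset V) : ℝ :=
  if u ∈ X ∧ v ∈ X then S.card - 2 + ∑ w ∈ X, triangleWeight G u v S w else 0

variable {G : SimpleGraph V} [DecidableRel G.Adj] {u v : V} {S : Finset V}

theorem triangleWeight_symm (w : V) : triangleWeight G u v S w = triangleWeight G v u S w := by
  simp only [triangleWeight, and_comm]

theorem facetCorrection_symm : facetCorrection G u v S = facetCorrection G v u S := by
  ext X
  simp only [facetCorrection, and_comm, triangleWeight_symm (u := u)]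

theorem neg_one_le_triangleWeight (w : V) : -1 ≤ triangleWeight G u v S w := by
  unfold triangleWeight
  split_ifs <;> norm_num

theorem triangleWeight_eq_zero (hS : ∀ w ∈ S, G.Adj u w ∧ G.Adj v w) {w : V}
    (h : ¬ (G.Adj u w ∧ G.Adj v w)) : triangleWeight G u v S w = 0 := by
  rw [triangleWeight, if_neg fun hw => h (hS w hw), if_neg h]

theorem card_add_sum_triangleWeight {T : Finset V} (hT : ∀ w ∈ T, G.Adj u w ∧ G.Adj v w) :
    (S.card : ℝ) + ∑ w ∈ T, triangleWeight G u v S w = (S \ T).card + (T \ S).card := by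
  rw [← Finset.sum_inter_add_sum_sdiff T S, ← Finset.card_sdiff_add_card_inter S T]
  rw [Finset.sum_congr (s₁ := T \ S) rfl fun w hw => show triangleWeight G u v S w = 1 by
      rw [Finset.mem_sdiff] at hw
      rw [triangleWeight, if_neg hw.2, if_pos (hT w hw.1)],
    Finset.sum_congr (s₁ := T ∩ S) rfl fun w hw => show triangleWeight G u v S w = -1 by
      rw [triangleWeight, if_pos (Finset.mem_inter.1 hw).2]]
  rw [Finset.inter_comm S T]
  simp

theorem secondDiff_facetCorrection_self (hS : ∀ w ∈ S, G.Adj u w ∧ G.Adj v w) (huv : u ≠ v)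
    {T : Finset V} (hu : u ∉ T) (hv : v ∉ T) :
    secondDiff u v T (facetCorrection G u v S) =
      2 - (S.card + ∑ w ∈ T, triangleWeight G u v S w) := by
  have h1 : ¬ v ∈ insert u T := by simp [huv.symm, hv]
  have h2 : ¬ u ∈ insert v T := by simp [huv, hu]
  simp only [secondDiff_apply, facetCorrection, h1, h2, hu, Finset.mem_insert_self,
    Finset.mem_insert_of_mem, and_true, and_false, false_and, if_true, if_false]
  rw [Finset.sum_insert h2, Finset.sum_insert hv, triangleWeight_eq_zero hS (w := u) (by simp),
    triangleWeight_eq_zero hS (w := v) (by simp)]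
  ring

theorem secondDiff_facetCorrection_left {b : V} (huv : u ≠ v) (hbu : u ≠ b) (hbv : b ≠ v)
    {T : Finset V} (hu : u ∉ T) (hb : b ∉ T) :
    secondDiff u b T (facetCorrection G u v S) = if v ∈ T then -triangleWeight G u v S b else 0 := by
  by_cases hv : v ∈ T
  · have h2 : ¬ u ∈ insert b T := by simp [hbu, hu]
    simp only [secondDiff_apply, facetCorrection, h2, hu, hv, Finset.mem_insert_self,
      Finset.mem_insert_of_mem, and_self, false_and, if_true, if_false]
    rw [Finset.sum_insert hu, Finset.sum_insert h2, Finset.sum_insert hb]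
    ring
  · simp [secondDiff_apply, facetCorrection, hv, hbv.symm, huv.symm]

theorem secondDiff_facetCorrection_disjoint {a b : V} (hab : a ≠ b) (hau : a ≠ u) (hav : a ≠ v)
    (hbu : b ≠ u) (hbv : b ≠ v) {T : Finset V} (ha : a ∉ T) (hb : b ∉ T) :
    secondDiff a b T (facetCorrection G u v S) = 0 := by
  simp only [secondDiff_apply, facetCorrection, Finset.mem_insert, hau.symm, hav.symm, hbu.symm,
    hbv.symm, false_or]
  split_ifs
  · rw [Finset.sum_insert (s := insert b T) (by simp [hab, ha]), Finset.sum_insert ha,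
      Finset.sum_insert hb]
    ring
  · ring

theorem secondDiff_facetCorrection_left_le (hS : ∀ w ∈ S, G.Adj u w ∧ G.Adj v w) {b : V}
    (huv : u ≠ v) (hbu : u ≠ b) (hbv : b ≠ v) {T : Finset V} (hu : u ∉ T) (hb : b ∉ T) :
    secondDiff u b T (facetCorrection G u v S) ≤ 1 ∧
      (¬ G.Adj u b → secondDiff u b T (facetCorrection G u v S) = 0) := by
  rw [secondDiff_facetCorrection_left huv hbu hbv hu hb]
  refine ⟨?_, fun h => ?_⟩
  · have := neg_one_le_triangleWeight (G := G) (u := u) (v := v) (S := S) b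
    split_ifs <;> linarith
  · rw [triangleWeight_eq_zero hS fun h' => h h'.1, neg_zero, ite_self]

theorem secondDiff_facetCorrection_le (hS : ∀ w ∈ S, G.Adj u w ∧ G.Adj v w) (huv : u ≠ v)
    {a b : V} (hab : a ≠ b) (hne : s(a, b) ≠ s(u, v)) {T : Finset V} (ha : a ∉ T) (hb : b ∉ T) :
    secondDiff a b T (facetCorrection G u v S) ≤ 1 ∧
      (¬ G.Adj a b → secondDiff a b T (facetCorrection G u v S) = 0) := by
  have hS' : ∀ w ∈ S, G.Adj v w ∧ G.Adj u w := fun w hw => (hS w hw).symm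
  rw [ne_eq, Sym2.eq_iff, not_or, not_and, not_and] at hne
  by_cases hau : a = u
  · subst hau
    exact secondDiff_facetCorrection_left_le hS huv hab (hne.1 rfl) ha hb
  by_cases hav : a = v
  · subst hav
    rw [facetCorrection_symm]
    exact secondDiff_facetCorrection_left_le hS' huv.symm hab (hne.2 rfl) ha hb
  by_cases hbu : b = u
  · subst hbu
    rw [secondDiff_comm, G.adj_comm]
    exact secondDiff_facetCorrection_left_le hS huv hab.symm hav hb ha
  by_cases hbv : b = v
  · subst hbv
    rw [secondDiff_comm, G.adj_comm, facetCorrection_symm]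
    exact secondDiff_facetCorrection_left_le hS' huv.symm hab.symm hau hb ha
  rw [secondDiff_facetCorrection_disjoint hab hau hav hbu hbv ha hb]
  exact ⟨zero_le_one, fun _ => rfl⟩

variable [Fintype V]

variable (G u v S) in
/-- A point in the relative interior of the facet attached to the triplet `({u, v}, S)`. -/
def facetWitness : Finset V → ℝ := (2 : ℝ) • zonotopeFun G - facetCorrection G u v S

theorem secondDiff_facetWitness {a b : V} (hab : a ≠ b) {T : Finset V} (ha : a ∉ T)
    (hb : b ∉ T) : secondDiff a b T (facetWitness G u v S) =
      2 * (if G.Adj a b then 1 else 0) - secondDiff a b T (facetCorrection G u v S) := by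
  rw [facetWitness, map_sub, map_smul, secondDiff_zonotopeFun G hab ha hb, smul_eq_mul]

theorem facetWitness_mem (huv : G.Adj u v) (hS : ∀ w ∈ S, G.Adj u w ∧ G.Adj v w) :
    facetWitness G u v S ∈ cliqueSpace G := by
  refine ⟨?_, fun a b T hab hadj ha hb => ?_⟩
  · simp [facetWitness, facetCorrection, (zonotopeFun_mem G).1]
  · have hne : s(a, b) ≠ s(u, v) := fun h => hadj (by
      rw [← SimpleGraph.mem_edgeSet, h]; exact huv)
    rw [secondDiff_facetWitness hab ha hb, if_neg hadj,
      (secondDiff_facetCorrection_le hS huv.ne hab hne ha hb).2 hadj]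
    ring

theorem pairDiff_facetWitness_eq (huv : G.Adj u v) (hS : ∀ w ∈ S, G.Adj u w ∧ G.Adj v w)
    {T : Finset V} (hT : ∀ w ∈ T, G.Adj u w ∧ G.Adj v w) :
    pairDiff (s(u, v), T) (facetWitness G u v S) = (S \ T).card + (T \ S).card := by
  have hu : u ∉ T := fun h => (hT u h).1.ne rfl
  have hv : v ∉ T := fun h => (hT v h).2.ne rfl
  rw [pairDiff_mk, secondDiff_facetWitness huv.ne hu hv, if_pos huv,
    secondDiff_facetCorrection_self hS huv.ne hu hv, card_add_sum_triangleWeight hT]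
  ring

theorem pairDiff_facetWitness_pos (huv : G.Adj u v) (hS : ∀ w ∈ S, G.Adj u w ∧ G.Adj v w)
    {t : Sym2 V × Finset V} (ht : t ∈ tripletFinset G) (hne : t ≠ (s(u, v), S)) :
    0 < pairDiff t (facetWitness G u v S) := by
  obtain ⟨a, b, T, rfl, hab, hT⟩ := mem_tripletFinset.1 ht
  by_cases h : s(a, b) = s(u, v)
  · have hT' : ∀ w ∈ T, G.Adj u w ∧ G.Adj v w := by
      rcases Sym2.eq_iff.1 h with ⟨rfl, rfl⟩ | ⟨rfl, rfl⟩
      · exact hT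
      · exact fun w hw => (hT w hw).symm
    rw [h] at hne ⊢
    rw [pairDiff_facetWitness_eq huv hS hT']
    have hTS : T ≠ S := fun h => hne (by rw [h])
    have : 0 < (S \ T).card + (T \ S).card := by
      by_contra! hle
      have h1 : S \ T = ∅ := Finset.card_eq_zero.1 (by omega)
      have h2 : T \ S = ∅ := Finset.card_eq_zero.1 (by omega)
      rw [Finset.sdiff_eq_empty_iff_subset] at h1 h2
      exact hTS (h2.antisymm h1)
    exact_mod_cast this
  · have ha : a ∉ T := fun h => (hT a h).1.ne rfl
    have hb : b ∉ T := fun h => (hT b h).2.ne rfl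
    rw [pairDiff_mk, secondDiff_facetWitness hab.ne ha hb, if_pos hab]
    linarith [(secondDiff_facetCorrection_le hS huv.ne hab.ne h ha hb).1]

end

/-! ### The deformation cone as a cone of submodular functions -/

section

variable {V : Type*} [Fintype V] [DecidableEq V]

variable (V) in
/-- The linear map sending a virtual polytope to the values of its support function on indicator
vectors. -/
def submodularFun : VirtualPolytope (V → ℝ) →ₗ[ℝ] (Finset V → ℝ) :=
  let φ : VirtualPolytope (V → ℝ) →+ (Finset V → ℝ) :=
    (Algebra.GrothendieckAddGroup.lift (M := Polytope (V → ℝ)) (G := Finset V → ℝ))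
      { toFun := fun P S => P.supportFun (indicatorVec S)
        map_zero' := funext fun _ => Polytope.supportFun_zero _
        map_add' := fun P Q => funext fun _ => Polytope.supportFun_add P Q _ }
  have hφ : ∀ P S, φ (VirtualPolytope.of P) S = P.supportFun (indicatorVec S) := fun P S =>
    congrFun (DFunLike.congr_fun ((Algebra.GrothendieckAddGroup.lift (M := Polytope (V → ℝ))
      (G := Finset V → ℝ)).symm_apply_apply _) P) S
  have hdil : ∀ (a : ℝ≥0) x, φ (VirtualPolytope.dilate a x) = (a : ℝ) • φ x := fun a x =>
    DFunLike.congr_fun (f := φ.comp (VirtualPolytope.dilate a))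
      (g := (DistribSMul.toAddMonoidHom (Finset V → ℝ) (a : ℝ)).comp φ)
      (VirtualPolytope.hom_ext fun P => funext fun S => by
        simp [VirtualPolytope.dilate_of, hφ, Polytope.supportFun_dilate]) x
  { φ with
    map_smul' := fun r x => by
      obtain ⟨a, b, hr⟩ := VirtualPolytope.exists_eq_sub r
      change φ (r • x) = r • φ x
      rw [VirtualPolytope.smul_eq hr, map_sub, hdil, hdil, hr, sub_smul] }

theorem submodularFun_of (P : Polytope (V → ℝ)) (S : Finset V) :
    submodularFun V (VirtualPolytope.of P) S = P.supportFun (indicatorVec S) :=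
  congrFun (DFunLike.congr_fun ((Algebra.GrothendieckAddGroup.lift (M := Polytope (V → ℝ))
    (G := Finset V → ℝ)).symm_apply_apply _) P) S

namespace Polytope.IsWeakMinkowskiSummand

variable {G : SimpleGraph V} {P : Polytope (V → ℝ)}

theorem supportFun_add (hP : P.IsWeakMinkowskiSummand (graphicalZonotope G)) {c d : V → ℝ}
    (h : ∀ u v, G.Adj u v → c u < c v → d u ≤ d v) :
    P.supportFun (c + d) = P.supportFun c + P.supportFun d := by
  obtain ⟨a, Q, hPQ⟩ := hP
  have key : ∀ e, P.supportFun e + Q.supportFun e = a * (graphicalZonotope G).supportFun e :=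
    fun e => by rw [← Polytope.supportFun_add, hPQ, supportFun_dilate]
  have h1 := key (c + d)
  rw [supportFun_graphicalZonotope_add G h, mul_add, ← key, ← key] at h1
  linarith [P.supportFun_add_le c d, Q.supportFun_add_le c d]

theorem isComonotone (hP : P.IsWeakMinkowskiSummand (graphicalZonotope G)) : P.IsComonotone :=
  fun _ _ hcd => hP.supportFun_add fun u v _ => hcd u v

end Polytope.IsWeakMinkowskiSummand

variable {G : SimpleGraph V}

theorem secondDiff_submodularFun {P : Polytope (V → ℝ)}
    (hP : P.IsWeakMinkowskiSummand (graphicalZonotope G)) {u v : V} {S : Finset V} (huv : u ≠ v)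
    (hu : u ∉ S) (hv : v ∉ S) : secondDiff u v S (submodularFun V (VirtualPolytope.of P)) =
      P.supportFun (indicatorVec (insert u S)) + P.supportFun (indicatorVec (insert v S)) -
        P.supportFun (indicatorVec (insert u S) + indicatorVec (insert v S)) := by
  have h : Comonotone (indicatorVec (insert u (insert v S))) (indicatorVec S) := by
    apply Comonotone.symm
    intro a b hab
    simp only [indicatorVec, Finset.mem_insert] at hab ⊢
    split_ifs at hab ⊢ <;> simp_all <;> linarith
  rw [← indicatorVec_insert_add huv hu hv, hP.isComonotone _ _ h, secondDiff_apply]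
  simp only [submodularFun_of]
  ring

theorem submodularFun_mem {x : VirtualPolytope (V → ℝ)}
    (hx : x ∈ deformationCone (graphicalZonotope G)) :
    submodularFun V x ∈ cliqueSpace G ∧ IsSubmodular (submodularFun V x) := by
  obtain ⟨P, hP, rfl⟩ := hx
  have h0 : submodularFun V (VirtualPolytope.of P) ∅ = 0 := by
    rw [submodularFun_of, indicatorVec_empty, Polytope.supportFun_zero_right]
  refine ⟨⟨h0, fun u v S huv hadj hu hv => ?_⟩, h0, fun u v S huv hu hv => ?_⟩
  · rw [secondDiff_submodularFun hP huv hu hv, hP.supportFun_add, sub_self]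
    intro a b hab
    simp only [indicatorVec, Finset.mem_insert]
    by_cases ha : a ∈ S
    · simp only [ha, or_true, if_true]
      split_ifs <;> norm_num
    · by_cases hb : b ∈ S
      · simp only [hb, or_true, if_true]
        split_ifs <;> norm_num
      · have h1 : ¬ (a = u ∧ b = v) := by rintro ⟨rfl, rfl⟩; exact hadj hab
        have h2 : ¬ (a = v ∧ b = u) := by rintro ⟨rfl, rfl⟩; exact hadj hab.symm
        simp only [ha, hb, or_false]
        split_ifs <;> norm_num <;> simp_all
  · rw [secondDiff_submodularFun hP huv hu hv, sub_nonneg]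
    exact P.supportFun_add_le _ _

theorem exists_submodularFun_eq {f : Finset V → ℝ} (hf : f ∈ cliqueSpace G)
    (hf' : ∀ t ∈ tripletFinset G, 0 ≤ pairDiff t f) :
    ∃ x ∈ deformationCone (graphicalZonotope G), submodularFun V x = f := by
  have hsub := isSubmodular_of_pairDiff_nonneg hf hf'
  obtain ⟨r, hr, hrT⟩ := exists_pos_forall_le_mul (tripletFinset G) (fun t => pairDiff t f)
    (fun t => pairDiff t (zonotopeFun G)) fun t ht => by rw [pairDiff_zonotopeFun ht]; norm_num
  lift r to ℝ≥0 using hr.le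
  have hg : IsSubmodular ((r : ℝ) • zonotopeFun G - f) := by
    refine isSubmodular_of_pairDiff_nonneg
      (sub_mem (Submodule.smul_mem _ _ (zonotopeFun_mem G)) hf) fun t ht => ?_
    rw [map_sub, map_smul, smul_eq_mul, sub_nonneg]
    exact hrT t ht
  refine ⟨VirtualPolytope.of (basePolytope f),
    ⟨_, ⟨r, basePolytope ((r : ℝ) • zonotopeFun G - f), ?_⟩, rfl⟩, ?_⟩
  · refine Polytope.IsComonotone.ext
      ((basePolytope_isComonotone hsub).add (basePolytope_isComonotone hg)) ?_ fun S => ?_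
    · intro c d hcd
      rw [Polytope.supportFun_dilate, Polytope.supportFun_dilate, Polytope.supportFun_dilate,
        supportFun_graphicalZonotope_add G fun u v _ => hcd u v, mul_add]
    · rw [Polytope.supportFun_add, supportFun_basePolytope_indicatorVec hsub,
        supportFun_basePolytope_indicatorVec hg, Polytope.supportFun_dilate]
      simp [zonotopeFun]
  · ext S
    rw [submodularFun_of, supportFun_basePolytope_indicatorVec hsub]

theorem eq_zero_of_submodularFun_eq_zero {x : VirtualPolytope (V → ℝ)}
    (hx : x ∈ Submodule.span ℝ
      (deformationCone (graphicalZonotope G) : Set (VirtualPolytope (V → ℝ))))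
    (h : submodularFun V x = 0) : x = 0 := by
  obtain ⟨_, ⟨P, hP, rfl⟩, _, ⟨Q, hQ, rfl⟩, rfl⟩ := mem_span_pointedCone hx
  have hPQ : P = Q := hP.isComonotone.ext hQ.isComonotone fun S => by
    have := congrFun h S
    rw [map_sub, Pi.sub_apply, submodularFun_of, submodularFun_of, Pi.zero_apply] at this
    linarith
  rw [hPQ, sub_self]

variable (G) in
/-- The span of the deformation cone of the graphical zonotope is isomorphic to the space of set
functions supported on cliques. -/
def spanEquivCliqueSpace :
    Submodule.span ℝ (deformationCone (graphicalZonotope G) : Set (VirtualPolytope (V → ℝ)))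
      ≃ₗ[ℝ] cliqueSpace G :=
  LinearEquiv.ofBijective
    ((submodularFun V).restrict (p := Submodule.span ℝ
      (deformationCone (graphicalZonotope G) : Set (VirtualPolytope (V → ℝ))))
      (q := cliqueSpace G) fun x hx => by
        obtain ⟨y, hy, z, hz, rfl⟩ := mem_span_pointedCone hx
        rw [map_sub]
        exact sub_mem (submodularFun_mem hy).1 (submodularFun_mem hz).1) <| by
    constructor
    · rw [← LinearMap.ker_eq_bot, LinearMap.ker_eq_bot']
      exact fun x hx => Subtype.ext
        (eq_zero_of_submodularFun_eq_zero x.2 (congrArg Subtype.val hx))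
    · intro f
      obtain ⟨r, hr, hrT⟩ := exists_pos_forall_le_mul (tripletFinset G) (fun t => -pairDiff t f.1)
        (fun t => pairDiff t (zonotopeFun G)) fun t ht => by
          rw [pairDiff_zonotopeFun ht]; norm_num
      obtain ⟨x, hx, hxf⟩ := exists_submodularFun_eq (f := f.1 + r • zonotopeFun G)
        (add_mem f.2 (Submodule.smul_mem _ r (zonotopeFun_mem G))) fun t ht => by
          rw [map_add, map_smul, smul_eq_mul]
          linarith [hrT t ht]
      obtain ⟨y, hy, hyf⟩ := exists_submodularFun_eq (f := r • zonotopeFun G)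
        (Submodule.smul_mem _ r (zonotopeFun_mem G)) fun t ht => by
          rw [map_smul, pairDiff_zonotopeFun ht, smul_eq_mul, mul_one]
          exact hr.le
      refine ⟨⟨x - y, sub_mem (Submodule.subset_span hx) (Submodule.subset_span hy)⟩,
        Subtype.ext ?_⟩
      change submodularFun V (x - y) = f.1
      rw [map_sub, hxf, hyf, add_sub_cancel_right]

theorem spanEquivCliqueSpace_apply (x : Submodule.span ℝ
    (deformationCone (graphicalZonotope G) : Set (VirtualPolytope (V → ℝ)))) :
    (spanEquivCliqueSpace G x : Finset V → ℝ) = submodularFun V x := rfl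

theorem exists_mem_span_submodularFun_eq {f : Finset V → ℝ} (hf : f ∈ cliqueSpace G) :
    ∃ x ∈ Submodule.span ℝ
      (deformationCone (graphicalZonotope G) : Set (VirtualPolytope (V → ℝ))),
      submodularFun V x = f :=
  ⟨(spanEquivCliqueSpace G).symm ⟨f, hf⟩, Subtype.property _, by
    rw [← spanEquivCliqueSpace_apply, LinearEquiv.apply_symm_apply]⟩

theorem mem_deformationCone_iff (x : VirtualPolytope (V → ℝ)) :
    x ∈ deformationCone (graphicalZonotope G) ↔ x ∈ Submodule.span ℝ
      (deformationCone (graphicalZonotope G) : Set (VirtualPolytope (V → ℝ))) ∧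
      ∀ t ∈ tripletFinset G, 0 ≤ (pairDiff t ∘ₗ submodularFun V) x := by
  refine ⟨fun hx => ⟨Submodule.subset_span hx, fun t ht =>
    (submodularFun_mem hx).2.pairDiff_nonneg ht⟩, fun ⟨hx, h⟩ => ?_⟩
  obtain ⟨y, hy, hyx⟩ := exists_submodularFun_eq (spanEquivCliqueSpace G ⟨x, hx⟩).2 h
  have := eq_zero_of_submodularFun_eq_zero (G := G) (sub_mem hx (Submodule.subset_span hy)) (by
    rw [map_sub, hyx]; exact sub_self _)
  rwa [sub_eq_zero.1 this]

instance : FiniteDimensional ℝ (Submodule.span ℝ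
    (deformationCone (graphicalZonotope G) : Set (VirtualPolytope (V → ℝ)))) :=
  Module.Finite.equiv (spanEquivCliqueSpace G).symm

theorem coneDim_deformationCone_graphicalZonotope (G : SimpleGraph V) :
    coneDim (deformationCone (graphicalZonotope G)) = ((inducedCliques G).ncard : Cardinal) := by
  rw [coneDim_eq_finrank, (spanEquivCliqueSpace G).finrank_eq, finrank_cliqueSpace]

theorem encard_coneFacets_deformationCone_graphicalZonotope (G : SimpleGraph V) :
    (coneFacets (deformationCone (graphicalZonotope G))).encard = (facetTriplets G).encard := by
  classical
  obtain ⟨z, hz, hzf⟩ := exists_mem_span_submodularFun_eq (zonotopeFun_mem G)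
  rw [← coe_tripletFinset]
  refine encard_coneFacets mem_deformationCone_iff hz (fun t ht => ?_) fun t ht => ?_
  · rw [LinearMap.comp_apply, hzf, pairDiff_zonotopeFun ht]
    exact one_pos
  · obtain ⟨u, v, S, rfl, huv, hS⟩ := mem_tripletFinset.1 ht
    obtain ⟨x, hx, hxf⟩ := exists_mem_span_submodularFun_eq (facetWitness_mem huv hS)
    refine ⟨x, hx, ?_, fun s hs hne => ?_⟩
    · rw [LinearMap.comp_apply, hxf, pairDiff_facetWitness_eq huv hS hS]
      simp
    · rw [LinearMap.comp_apply, hxf]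
      exact pairDiff_facetWitness_pos huv hS hs hne

theorem exists_mem_deformationCone_of_modular (G : SimpleGraph V) (y : V → ℝ) :
    ∃ x ∈ deformationCone (graphicalZonotope G), submodularFun V x = fun S => ∑ v ∈ S, y v :=
  exists_submodularFun_eq (sum_mem_cliqueSpace y) fun t ht => by
    obtain ⟨u, v, S, rfl, huv, hS⟩ := mem_tripletFinset.1 ht
    rw [pairDiff_mk, secondDiff_sum_eq_zero y huv.ne (fun h => (hS u h).1.ne rfl)
      fun h => (hS v h).2.ne rfl]

variable (G) in
/-- The lineality space of the deformation cone is the space of translations. -/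
def linealEquiv : (deformationCone (graphicalZonotope G)).lineal ≃ₗ[ℝ] (V → ℝ) :=
  LinearEquiv.ofBijective ((LinearMap.funLeft ℝ ℝ fun v : V => ({v} : Finset V)) ∘ₗ
    submodularFun V ∘ₗ (deformationCone (graphicalZonotope G)).lineal.subtype) <| by
    constructor
    · rw [← LinearMap.ker_eq_bot, LinearMap.ker_eq_bot']
      rintro ⟨x, hx, hx'⟩ h
      refine Subtype.ext
        (eq_zero_of_submodularFun_eq_zero (G := G) (Submodule.subset_span hx) ?_)
      have hneg := (submodularFun_mem hx').2
      rw [map_neg] at hneg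
      ext S
      rw [(submodularFun_mem hx).2.eq_sum hneg]
      exact Finset.sum_eq_zero fun v _ => congrFun h v
    · intro y
      obtain ⟨x, hx, hxy⟩ := exists_mem_deformationCone_of_modular G y
      obtain ⟨x', hx', hxy'⟩ := exists_mem_deformationCone_of_modular G (-y)
      have h0 : x + x' = 0 := eq_zero_of_submodularFun_eq_zero (G := G)
        (Submodule.subset_span (add_mem hx hx')) (by
          rw [map_add, hxy, hxy']; ext S; simp)
      refine ⟨⟨x, hx, ?_⟩, ?_⟩
      · change -x ∈ deformationCone (graphicalZonotope G)
        rwa [← eq_neg_of_add_eq_zero_right h0]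
      · ext v
        change submodularFun V x {v} = y v
        rw [hxy]
        exact Finset.sum_singleton y v

end

end

theorem mainTheorem3 {V : Type*} [Fintype V] [DecidableEq V] (G : SimpleGraph V) :
    coneDim (deformationCone (graphicalZonotope G)) = ((inducedCliques G).ncard : Cardinal) ∧
    Module.rank ℝ (deformationCone (graphicalZonotope G)).lineal =
      ((Fintype.card V : ℕ) : Cardinal) ∧
    (coneFacets (deformationCone (graphicalZonotope G))).encard = (facetTriplets G).encard :=
  ⟨coneDim_deformationCone_graphicalZonotope G, by rw [(linealEquiv G).rank_eq, rank_fun'],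
    encard_coneFacets_deformationCone_graphicalZonotope G⟩
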